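/- Let $\mathcal H$ be a finite-dimensional complex Hilbert space, let $\mathcal H_R\subseteq\mathcal H$ be a subspace of dimension $d_R\ge 1$ with orthogonal projector $\Pi_R$, and let $B$ be an observable (hermitian operator) on $\mathcal H$ with operator norm $\|B\|_\infty$. Write $\langle A\rangle_{\mathrm{mc}}=\operatorname{Tr}[A\,\Pi_R/d_R]$ for the microcanonical expectation value of an operator $A$ on $\mathcal H$. Let $\psi$ be a Haar-random pure state of $\mathcal H_R$, i.e. $\psi=|\psi\rangle\langle\psi|$ with $|\psi\rangle$ uniformly distributed on the unit sphere of $\mathcal H_R$, and put $$\sigma_\psi^2=\operatorname{Tr}\big[(B-\operatorname{Tr}[B\psi])^2\,\psi\big],\qquad \sigma_{\mathrm{mc}}^2=\big\langle (B-\langle B\rangle_{\mathrm{mc}})^2\big\rangle_{\mathrm{mc}} .$$ Then, with $C=(36\pi^3)^{-1}$, for every $\varepsilon\ge 0$: $$\mathbb P\big\{|\sigma_\psi^2-\sigma_{\mathrm{mc}}^2|>\|B\|_\infty^2\,\varepsilon\big\}\;\le\;\min_{0\le\delta\le\varepsilon}\Big(2e^{-C d_R(\varepsilon-\delta)}+2e^{-C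 d_R\delta^2}\Big)\;\le\;4\,e^{-\frac{C d_R}{2}\left(1+2\varepsilon-\sqrt{1+4\varepsilon}\right)},$$ where the minimum is attained, and moreover $$\mathbb P\big\{|\sigma_\psi^2-\sigma_{\mathrm{mc}}^2|>\|B\|_\infty^2\,\varepsilon\big\}\;\le\;4\,e^{-C d_R\left(1+2\varepsilon-\sqrt{1+4\varepsilon}\right)} .$$ -/

import Mathlib

open Set MeasureTheory

noncomputable section

/-- The uniform (normalised rotation invariant surface) probability measure on the unit sphere of
a finite-dimensional normed space, i.e. the cone measure of any Lebesgue (additive Haar) measure,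
normalised to total mass one. The normalisation removes the dependence on the scaling of the
additive Haar measure. On a Euclidean space it is the usual uniform measure. -/
def uniformSphere (E : Type*) [NormedAddCommGroup E] [NormedSpace ℝ E] [FiniteDimensional ℝ E]
    [LocallyCompactSpace E] [MeasurableSpace E] [BorelSpace E] :
    Measure (Metric.sphere (0 : E) 1) :=
  ((Measure.addHaar (G := E)).toSphere univ)⁻¹ • (Measure.addHaar (G := E)).toSphere

/-- `𝒫₁(R)`: the set of pure states (density operators `|v⟩⟨v|`) of the subspace `R` of the
Hilbert space `H`, i.e. of all orthogonal projectors of rank one whose range lies in `R`. -/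
def pureStates {H : Type*} [NormedAddCommGroup H] [InnerProductSpace ℂ H]
    (R : Submodule ℂ H) : Set (H →L[ℂ] H) :=
  {ψ | (ψ : H →ₗ[ℂ] H).IsSymmetricProjection ∧
    Module.finrank ℂ (LinearMap.range (ψ : H →ₗ[ℂ] H)) = 1 ∧
    LinearMap.range (ψ : H →ₗ[ℂ] H) ≤ R}

/-- For a unit vector `v`, the operator `|v⟩⟨v|` is a projector of rank one. -/
theorem rankOne_mem_pureStates {H : Type*} [NormedAddCommGroup H] [InnerProductSpace ℂ H]
    (R : Submodule ℂ H) (v : Metric.sphere (0 : R) 1) :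
    InnerProductSpace.rankOne ℂ (v : R).1 (v : R).1 ∈ pureStates R := by
  have hv : ‖(v : R).1‖ = 1 := mem_sphere_zero_iff_norm.1 v.2
  have h0 : (v : R).1 ≠ 0 := by
    intro h
    simp [h] at hv
  have hr : LinearMap.range
      ((InnerProductSpace.rankOne ℂ (v : R).1 (v : R).1 : H →L[ℂ] H) : H →ₗ[ℂ] H)
      = Submodule.span ℂ {(v : R).1} := by
    ext x
    simp only [LinearMap.mem_range, Submodule.mem_span_singleton]
    constructor
    · rintro ⟨y, rfl⟩
      exact ⟨_, rfl⟩
    · rintro ⟨a, rfl⟩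
      refine ⟨a • (v : R).1, ?_⟩
      simp [hv]
  refine ⟨InnerProductSpace.isSymmetricProjection_rankOne_self hv, ?_, ?_⟩
  · rw [hr]
    exact finrank_span_singleton h0
  · rw [hr, Submodule.span_singleton_le_iff_mem]
    exact (v : R).2

/-- The pure state `|v⟩⟨v|` of a unit vector `v` of the subspace `R`. -/
def ketBra {H : Type*} [NormedAddCommGroup H] [InnerProductSpace ℂ H]
    (R : Submodule ℂ H) (v : Metric.sphere (0 : R) 1) : pureStates R :=
  ⟨InnerProductSpace.rankOne ℂ (v : R).1 (v : R).1, rankOne_mem_pureStates R v⟩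

/-- The law of a Haar random pure state `ψ ∈ 𝒫₁(R)`: the unitarily invariant probability measure
on the pure states of `R`, obtained as the law of `|v⟩⟨v|` for a uniformly distributed unit
vector `v` of `R`. -/
def haarPureState {H : Type*} [NormedAddCommGroup H] [InnerProductSpace ℂ H]
    [FiniteDimensional ℂ H] [MeasurableSpace H] [BorelSpace H] (R : Submodule ℂ H) :
    Measure (pureStates R) :=
  (uniformSphere R).map (ketBra R)

/-- The expectation value `Tr[A ρ]`. It is a real number when `A` and `ρ` are hermitian. -/
def expectation {H : Type*} [NormedAddCommGroup H] [InnerProductSpace ℂ H]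
    (ρ A : H →L[ℂ] H) : ℝ :=
  (LinearMap.trace ℂ H ((A * ρ : H →L[ℂ] H) : H →ₗ[ℂ] H)).re

/-- The variance `Tr[(B - Tr[B ρ])² ρ]` of the observable `B` in the state `ρ`. -/
def stateVariance {H : Type*} [NormedAddCommGroup H] [InnerProductSpace ℂ H]
    (ρ B : H →L[ℂ] H) : ℝ :=
  expectation ρ ((B - ((expectation ρ B : ℝ) : ℂ) • (1 : H →L[ℂ] H)) ^ 2)

/-- The microcanonical state `Π_R / d_R`. -/
def microcanonicalState {H : Type*} [NormedAddCommGroup H] [InnerProductSpace ℂ H]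
    [FiniteDimensional ℂ H] (R : Submodule ℂ H) : H →L[ℂ] H :=
  ((Module.finrank ℂ R : ℂ))⁻¹ • R.starProjection

/-- The map `v ↦ |v⟩⟨v|` is continuous. -/
theorem continuous_ketBra {H : Type*} [NormedAddCommGroup H] [InnerProductSpace ℂ H]
    (R : Submodule ℂ H) : Continuous (ketBra R) := by
  unfold ketBra
  refine Continuous.subtype_mk ?_ _
  have hc : Continuous fun v : Metric.sphere (0 : R) 1 => (v : R).1 := by fun_prop
  exact (ContinuousLinearMap.smulRightL ℂ H H).continuous₂.comp
    (((innerSL ℂ (E := H)).continuous.comp hc).prodMk hc)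

/-- The uniform measure on the sphere of a nontrivial space has total mass one. -/
instance isProbabilityMeasure_uniformSphere (E : Type*) [NormedAddCommGroup E] [NormedSpace ℝ E]
    [FiniteDimensional ℝ E] [LocallyCompactSpace E] [MeasurableSpace E] [BorelSpace E]
    [Nontrivial E] : IsProbabilityMeasure (uniformSphere E) := by
  constructor
  unfold uniformSphere
  rw [Measure.smul_apply, smul_eq_mul]
  refine ENNReal.inv_mul_cancel ?_ (measure_ne_top _ _)
  rw [Ne, Measure.measure_univ_eq_zero]
  exact Measure.toSphere_ne_zero _

/-- The law of a random pure state of a nonzero subspace has total mass one. -/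
theorem isProbabilityMeasure_haarPureState {H : Type*} [NormedAddCommGroup H]
    [InnerProductSpace ℂ H] [FiniteDimensional ℂ H] [MeasurableSpace H] [BorelSpace H]
    (R : Submodule ℂ H) (hR : R ≠ ⊥) : IsProbabilityMeasure (haarPureState R) := by
  have : Nontrivial R := Submodule.nontrivial_iff_ne_bot.2 hR
  exact Measure.isProbabilityMeasure_map (continuous_ketBra R).measurable.aemeasurable

end

/-! With b the microcanonical mean of B and D = B - b, the variance in ψ is ⟨D²⟩_ψ - (⟨B⟩_ψ - b)².
It therefore differs from the microcanonical variance by X - Y², where X and Y are the deviations of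
⟨D²⟩_ψ and ⟨B⟩_ψ from their microcanonical means. If |X| ≤ δ‖B‖² and Y² ≤ (ε - δ)‖B‖², the
difference is at most ε‖B‖² in absolute value, so a union bound leaves two tails of quadratic forms
on the sphere of R.

Such tails (`uniformSphere_real_lt_inner_sub_le`) come from a Chernoff argument: the uniform measure
of a set is the Gaussian measure of the cone over it, and the exponentially tilted Gaussian integral
factorises in an eigenbasis. The resulting rates 1/32 and 1/128 exceed 2C, which leaves room for the
final bound without the factor 1/2. -/

/-- Since (1 + x + x²)(1 - x) = 1 - x³, the linear bound on exp suffices for x ≤ 0; for x ≥ 0 its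
quadratic term makes up the deficit x³. -/
theorem inv_one_sub_le_exp_add_sq {x : ℝ} (hx : |x| ≤ 1 / 2) :
    (1 - x)⁻¹ ≤ Real.exp (x + x ^ 2) := by
  obtain ⟨h1, h2⟩ := abs_le.1 hx
  rw [inv_le_iff_one_le_mul₀ (by linarith)]
  rcases le_total 0 x with h0 | h0
  · have h := Real.quadratic_le_exp_of_nonneg (x := x + x ^ 2) (by positivity)
    have h' : 0 ≤ (1 - x) * (1 + x) ^ 2 / 2 - x := by nlinarith
    calc (1 : ℝ) ≤ 1 + x ^ 2 * ((1 - x) * (1 + x) ^ 2 / 2 - x) := by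
          linarith [mul_nonneg (sq_nonneg x) h']
      _ = (1 + (x + x ^ 2) + (x + x ^ 2) ^ 2 / 2) * (1 - x) := by ring
      _ ≤ _ := mul_le_mul_of_nonneg_right h (by linarith)
  · have h := Real.add_one_le_exp (x + x ^ 2)
    calc (1 : ℝ) ≤ (x + x ^ 2 + 1) * (1 - x) := by nlinarith [pow_nonneg (neg_nonneg.2 h0) 3]
      _ ≤ _ := mul_le_mul_of_nonneg_right h (by linarith)

/-! ### Gaussian integrals and cone measure -/

/-- Integration of a radial function over a cone. -/
theorem integral_indicator_cone_fun_norm {E : Type*} [NormedAddCommGroup E] [NormedSpace ℝ E]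
    [FiniteDimensional ℝ E] [MeasurableSpace E] [BorelSpace E] [Nontrivial E]
    (μ : Measure E) [μ.IsAddHaarMeasure] (K : Set E) (S : Set (Metric.sphere (0 : E) 1))
    (hS : MeasurableSet S) (hK : ∀ (v : Metric.sphere (0 : E) 1) (r : ℝ), 0 < r →
      (r • (v : E) ∈ K ↔ v ∈ S)) (f : ℝ → ℝ) :
    ∫ x, K.indicator (fun x => f ‖x‖) x ∂μ =
      μ.toSphere.real S * ∫ r : Ioi (0 : ℝ), f r ∂.volumeIoiPow (Module.finrank ℝ E - 1) := by
  calc ∫ x, K.indicator (fun x => f ‖x‖) x ∂μ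
      = ∫ x : ({(0)}ᶜ : Set E), K.indicator (fun x => f ‖x‖) x ∂(μ.comap (↑)) := by
        rw [integral_subtype_comap (measurableSet_singleton _).compl
          fun x => K.indicator (fun x => f ‖x‖) x, restrict_compl_singleton]
    _ = ∫ x : ({(0)}ᶜ : Set E), (fun p : Metric.sphere (0 : E) 1 × Ioi (0 : ℝ) =>
          S.indicator (fun _ => (1 : ℝ)) p.1 * f p.2) (homeomorphUnitSphereProd E x)
          ∂(μ.comap (↑)) := by
        refine integral_congr_ae (.of_forall fun x => ?_)
        have hx : 0 < ‖(x : E)‖ := norm_pos_iff.2 x.2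
        have h := hK (homeomorphUnitSphereProd E x).1 ‖(x : E)‖ hx
        rw [homeomorphUnitSphereProd_apply_fst_coe, smul_inv_smul₀ hx.ne'] at h
        by_cases hxK : (x : E) ∈ K
        · simp [hxK, h.1 hxK]
        · simp [hxK, mt h.2 hxK]
    _ = ∫ p, S.indicator (fun _ => (1 : ℝ)) p.1 * f p.2
          ∂μ.toSphere.prod (.volumeIoiPow (Module.finrank ℝ E - 1)) :=
        μ.measurePreserving_homeomorphUnitSphereProd.integral_comp
          (Homeomorph.measurableEmbedding _)
          fun p : Metric.sphere (0 : E) 1 × Ioi (0 : ℝ) =>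
            S.indicator (fun _ => (1 : ℝ)) p.1 * f p.2
    _ = _ := by
        rw [integral_prod_mul (S.indicator fun _ => (1 : ℝ)) fun r : Ioi (0 : ℝ) => f r,
          integral_indicator_const _ hS, smul_eq_mul, mul_one]

/-- The uniform measure on the sphere is the cone measure of any radial density. -/
theorem uniformSphere_real_mul_integral_fun_norm {E : Type*} [NormedAddCommGroup E]
    [NormedSpace ℝ E] [FiniteDimensional ℝ E] [LocallyCompactSpace E] [MeasurableSpace E]
    [BorelSpace E] [Nontrivial E] (K : Set E) (S : Set (Metric.sphere (0 : E) 1))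
    (hS : MeasurableSet S) (hK : ∀ (v : Metric.sphere (0 : E) 1) (r : ℝ), 0 < r →
      (r • (v : E) ∈ K ↔ v ∈ S)) (f : ℝ → ℝ) :
    (uniformSphere E).real S * ∫ x : E, f ‖x‖ ∂Measure.addHaar =
      ∫ x : E, K.indicator (fun x => f ‖x‖) x ∂Measure.addHaar := by
  have h1 := integral_indicator_cone_fun_norm (Measure.addHaar (G := E)) K S hS hK f
  have h2 := integral_indicator_cone_fun_norm (Measure.addHaar (G := E)) univ univ .univ
    (by simp) f
  simp only [indicator_univ] at h2
  have h3 : ((Measure.addHaar (G := E)).toSphere.real univ) ≠ 0 := by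
    rw [measureReal_def, ENNReal.toReal_ne_zero, Ne, Measure.measure_univ_eq_zero]
    exact ⟨Measure.toSphere_ne_zero _, measure_ne_top _ _⟩
  rw [h1, h2, uniformSphere, measureReal_ennreal_smul_apply, ENNReal.toReal_inv, ← measureReal_def]
  field_simp

/-- The Gaussian integral with respect to an additive Haar measure in an orthonormal basis. -/
theorem exists_integral_gaussian_orthonormalBasis {E : Type*} [NormedAddCommGroup E]
    [InnerProductSpace ℂ E] [FiniteDimensional ℂ E] [MeasurableSpace E] [BorelSpace E]
    (μ : Measure E) [μ.IsAddHaarMeasure] {n : ℕ} (b : OrthonormalBasis (Fin n) ℂ E) :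
    ∃ k : ℝ, 0 < k ∧ ∀ c : Fin n → ℝ, (∀ i, 0 < c i) →
      Integrable (fun x => Real.exp (-∑ i, c i * ‖b.repr x i‖ ^ 2)) μ ∧
      ∫ x, Real.exp (-∑ i, c i * ‖b.repr x i‖ ^ 2) ∂μ = k * ∏ i, (c i)⁻¹ := by
  let L' : E ≃L[ℂ] (Fin n → ℂ) :=
    b.repr.toContinuousLinearEquiv.trans (EuclideanSpace.equiv (Fin n) ℂ)
  let L : E ≃L[ℝ] (Fin n → ℂ) := (L'.toLinearEquiv.restrictScalars ℝ).toContinuousLinearEquiv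
  have hL : ∀ x i, L x i = b.repr x i := fun _ _ => rfl
  have : (μ.map L).IsAddHaarMeasure := L.isAddHaarMeasure_map μ
  let e := (μ.map L).addHaarScalarFactor volume
  have he : μ.map L = e • volume := Measure.isAddLeftInvariant_eq_smul _ _
  have he0 : 0 < (e : ℝ) := Measure.addHaarScalarFactor_pos_of_isAddHaarMeasure _ _
  refine ⟨e * Real.pi ^ n, by positivity, fun c hc => ?_⟩
  have hI : ∫ x, Real.exp (-∑ i, c i * ‖b.repr x i‖ ^ 2) ∂μ
      = e * Real.pi ^ n * ∏ i, (c i)⁻¹ := by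
    have h1 : ∫ x, Real.exp (-∑ i, c i * ‖b.repr x i‖ ^ 2) ∂μ
        = ∫ z : Fin n → ℂ, Real.exp (-∑ i, c i * ‖z i‖ ^ 2) ∂(μ.map L) :=
      (L.toHomeomorph.measurableEmbedding.integral_map
        fun z : Fin n → ℂ => Real.exp (-∑ i, c i * ‖z i‖ ^ 2)).symm
    rw [h1, he, integral_smul_nnreal_measure]
    have h2 : ∀ z : Fin n → ℂ, Real.exp (-∑ i, c i * ‖z i‖ ^ 2)
        = ∏ i, Real.exp (-c i * ‖z i‖ ^ 2) := by
      intro z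
      rw [← Real.exp_sum, ← Finset.sum_neg_distrib]
      simp
    simp_rw [h2]
    rw [integral_fintype_prod_volume_eq_prod (𝕜 := ℝ)
      fun i (z : ℂ) => Real.exp (-c i * ‖z‖ ^ 2)]
    simp_rw [fun i => GaussianFourier.integral_rexp_neg_mul_sq_norm (V := ℂ) (hc i)]
    simp [Complex.finrank_real_complex, div_eq_mul_inv, Finset.prod_mul_distrib, NNReal.smul_def,
      mul_assoc]
  refine ⟨?_, hI⟩
  -- A non-integrable function has Bochner integral 0, so the positive value just computed forces
  -- integrability.
  by_contra h
  rw [integral_undef h] at hI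
  have : 0 < e * Real.pi ^ n * ∏ i, (c i)⁻¹ :=
    mul_pos (by positivity) (Finset.prod_pos fun i _ => inv_pos.2 (hc i))
  exact this.ne hI

/-! ### Chernoff bound for quadratic forms on the sphere -/

/-- This bounds the normalised tilted Gaussian integral, with u the centred eigenvalues. -/
theorem prod_inv_one_sub_le_exp {n : ℕ} (u : Fin n → ℝ) {K t : ℝ} (hK : 0 < K) (ht : 0 ≤ t)
    (htK : t ≤ K) (hu : ∑ i, u i = 0) (huK : ∀ i, |u i| ≤ K) :
    (∀ i, 0 < 1 - t / (4 * K ^ 2) * (u i - t)) ∧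
    ∏ i, (1 - t / (4 * K ^ 2) * (u i - t))⁻¹ ≤ Real.exp (-(n * t ^ 2 / (8 * K ^ 2))) := by
  -- This tilt minimises the final exponent n(2l²K² - lt).
  set l := t / (4 * K ^ 2) with hl
  have hx : ∀ i, |l * (u i - t)| ≤ 1 / 2 := fun i => by
    have h1 : |u i - t| ≤ 2 * K := by
      obtain ⟨h1, h2⟩ := abs_le.1 (huK i)
      exact abs_le.2 ⟨by linarith, by linarith⟩
    rw [abs_mul, abs_of_nonneg (by positivity : 0 ≤ l)]
    calc l * |u i - t| ≤ l * (2 * K) := by gcongr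
      _ = t / (2 * K) := by rw [hl]; field_simp; ring
      _ ≤ 1 / 2 := by rw [div_le_div_iff₀ (by positivity) (by norm_num)]; linarith
  have hpos : ∀ i, 0 < 1 - l * (u i - t) := fun i => by linarith [(abs_le.1 (hx i)).2]
  refine ⟨hpos, ?_⟩
  calc ∏ i, (1 - l * (u i - t))⁻¹
      ≤ ∏ i, Real.exp (l * (u i - t) + (l * (u i - t)) ^ 2) :=
        Finset.prod_le_prod (fun i _ => (inv_pos.2 (hpos i)).le)
          fun i _ => inv_one_sub_le_exp_add_sq (hx i)
    _ = Real.exp (∑ i, ((l - 2 * l ^ 2 * t) * u i + (l ^ 2 * u i ^ 2 + (l ^ 2 * t ^ 2 - l * t)))) := by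
        rw [← Real.exp_sum]
        congr 1
        exact Finset.sum_congr rfl fun i _ => by ring
    -- The terms linear in u sum to zero; u i ² and t² are each at most K².
    _ ≤ Real.exp (∑ i : Fin n, (l ^ 2 * K ^ 2 + (l ^ 2 * K ^ 2 - l * t))) := by
        rw [Finset.sum_add_distrib, ← Finset.mul_sum, hu, mul_zero, zero_add]
        refine Real.exp_le_exp.2 (Finset.sum_le_sum fun i _ => ?_)
        have := sq_le_sq' (abs_le.1 (huK i)).1 (abs_le.1 (huK i)).2
        gcongr
    _ = Real.exp (-(n * t ^ 2 / (8 * K ^ 2))) := by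
        rw [Finset.sum_const, Finset.card_univ, Fintype.card_fin, nsmul_eq_mul, hl]
        congr 1
        field_simp
        ring

/-- Upper tail bound for a quadratic form on the uniform sphere of a complex Hilbert space. -/
theorem uniformSphere_real_lt_inner_sub_le {E : Type*} [NormedAddCommGroup E]
    [InnerProductSpace ℂ E] [FiniteDimensional ℂ E] [MeasurableSpace E] [BorelSpace E]
    [Nontrivial E] (T : E →ₗ[ℂ] E) (hT : T.IsSymmetric) {K t : ℝ} (hK : 0 < K) (ht : 0 ≤ t)
    (h : ∀ x : E, ‖x‖ = 1 →
      |(inner ℂ x (T x)).re - (LinearMap.trace ℂ E T).re / Module.finrank ℂ E| ≤ K) :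
    (uniformSphere E).real {v | t < (inner ℂ (v : E) (T v)).re -
        (LinearMap.trace ℂ E T).re / Module.finrank ℂ E} ≤
      Real.exp (-(Module.finrank ℂ E * t ^ 2 / (8 * K ^ 2))) := by
  -- For t > K the event is empty; t ≤ K keeps the tilt small enough for a convergent Gaussian.
  rcases lt_or_ge K t with htK | htK
  · have h0 : {v : Metric.sphere (0 : E) 1 | t < (inner ℂ (v : E) (T v)).re -
        (LinearMap.trace ℂ E T).re / Module.finrank ℂ E} = ∅ := by
      refine eq_empty_of_forall_notMem fun v hv => ?_
      have := (abs_le.1 (h v (mem_sphere_zero_iff_norm.1 v.2))).2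
      exact absurd hv.out (by linarith)
    rw [h0, measureReal_empty]
    positivity
  generalize hn : Module.finrank ℂ E = n at h ⊢
  have hn0 : (n : ℝ) ≠ 0 := by
    rw [← hn]
    exact_mod_cast Module.finrank_pos.ne'
  set m : ℝ := (LinearMap.trace ℂ E T).re / n with hm
  let b := hT.eigenvectorBasis hn
  let a := hT.eigenvalues hn
  have hnorm : ∀ x : E, ‖x‖ ^ 2 = ∑ i, ‖b.repr x i‖ ^ 2 := fun x => by
    rw [← b.repr.norm_map x, EuclideanSpace.norm_sq_eq]
  have hin : ∀ x : E, (inner ℂ x (T x)).re = ∑ i, a i * ‖b.repr x i‖ ^ 2 := fun x => by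
    rw [← b.repr.inner_map_map, PiLp.inner_apply, Complex.re_sum]
    refine Finset.sum_congr rfl fun i _ => ?_
    rw [hT.eigenvectorBasis_apply_self_apply hn x i]
    change (inner ℂ (b.repr x i) ((a i : ℂ) * b.repr x i)).re = _
    rw [RCLike.inner_apply, mul_assoc, Complex.re_ofReal_mul, RCLike.mul_conj]
    norm_cast
  have hu : ∑ i, (a i - m) = 0 := by
    have : (LinearMap.trace ℂ E T).re = ∑ i, a i := by
      rw [hT.trace_eq_sum_eigenvalues hn]
      simp [a]
    rw [Finset.sum_sub_distrib, ← this, Finset.sum_const, Finset.card_univ, Fintype.card_fin,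
      nsmul_eq_mul, hm]
    field_simp
    ring
  have huK : ∀ i, |a i - m| ≤ K := fun i => by
    have := h (b i) (b.norm_eq_one i)
    rwa [hin, Finset.sum_eq_single i (by intro j _ hj; simp [hj.symm]) (by simp),
      b.repr_self, PiLp.single_apply, if_pos rfl, norm_one, one_pow, mul_one] at this
  obtain ⟨hpos, hprod⟩ := prod_inv_one_sub_le_exp (fun i => a i - m) hK ht htK hu huK
  set l := t / (4 * K ^ 2) with hl
  have hl0 : 0 ≤ l := by positivity
  obtain ⟨k, hk, hgauss⟩ := exists_integral_gaussian_orthonormalBasis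
    (Measure.addHaar (G := E)) b
  obtain ⟨-, h1⟩ := hgauss (fun _ => 1) fun _ => one_pos
  obtain ⟨hint, h2⟩ := hgauss _ hpos
  simp only [one_mul, ← hnorm, inv_one, Finset.prod_const_one, mul_one] at h1
  have hexp : ∀ x : E, -∑ i, (1 - l * (a i - m - t)) * ‖b.repr x i‖ ^ 2 =
      -‖x‖ ^ 2 + l * ((inner ℂ x (T x)).re - m * ‖x‖ ^ 2 - t * ‖x‖ ^ 2) := fun x => by
    rw [hin, hnorm]
    simp only [Finset.mul_sum, ← Finset.sum_sub_distrib, ← Finset.sum_neg_distrib,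
      ← Finset.sum_add_distrib]
    exact Finset.sum_congr rfl fun i _ => by ring
  simp only [hexp] at hint h2
  have hTc : Continuous T := T.continuous_of_finiteDimensional
  -- Both sides of the inequality defining the event are made homogeneous of degree 2, so it
  -- describes a cone.
  have hcone := uniformSphere_real_mul_integral_fun_norm (E := E)
    {x : E | t * ‖x‖ ^ 2 < (inner ℂ x (T x)).re - m * ‖x‖ ^ 2}
    {v : Metric.sphere (0 : E) 1 | t < (inner ℂ (v : E) (T v)).re - m}
    (measurableSet_lt measurable_const (Continuous.measurable (by fun_prop)))
    (fun v r hr => by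
      have hv : ‖(v : E)‖ = 1 := mem_sphere_zero_iff_norm.1 v.2
      have hr2 : 0 < r ^ 2 := by positivity
      have : (inner ℂ (r • (v : E)) (T (r • (v : E)))).re
          = r ^ 2 * (inner ℂ (v : E) (T v)).re := by
        rw [← Complex.coe_smul, map_smul, inner_smul_left, inner_smul_right, ← mul_assoc,
          Complex.conj_ofReal, ← Complex.ofReal_mul, Complex.re_ofReal_mul, pow_two]
      simp only [mem_ofPred_eq, this, norm_smul, hv, mul_one, Real.norm_eq_abs, sq_abs]
      rw [mul_comm t, mul_comm m, ← mul_sub, mul_lt_mul_iff_right₀ hr2])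
    (fun r => Real.exp (-r ^ 2))
  rw [h1] at hcone
  -- On the cone the tilt exponent is nonnegative, so the Gaussian is dominated there by the tilted
  -- one.
  have hle : (uniformSphere E).real {v | t < (inner ℂ (v : E) (T v)).re - m} * k ≤
      k * ∏ i, (1 - l * (a i - m - t))⁻¹ := by
    rw [hcone, ← h2]
    refine integral_mono_of_nonneg (.of_forall fun x => ?_) hint (.of_forall fun x => ?_)
    · exact indicator_nonneg (fun _ _ => (Real.exp_pos _).le) _
    · refine indicator_apply_le' (fun hx => ?_) fun _ => (Real.exp_pos _).le
      refine Real.exp_le_exp.2 ?_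
      have := hx.out
      linarith [mul_nonneg hl0 (sub_nonneg.2 this.le)]
  rw [mul_comm] at hle
  exact (le_of_mul_le_mul_left hle hk).trans hprod

/-! ### Expectations, variances and compressions to R -/

section expectation

variable {H : Type*} [NormedAddCommGroup H] [InnerProductSpace ℂ H]

theorem expectation_add (ρ A A' : H →L[ℂ] H) :
    expectation ρ (A + A') = expectation ρ A + expectation ρ A' := by
  simp [expectation, add_mul]

theorem expectation_real_smul (ρ A : H →L[ℂ] H) (c : ℝ) :
    expectation ρ ((c : ℂ) • A) = c * expectation ρ A := by
  simp [expectation]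

/-- The variance in terms of the second moment about an arbitrary real number. -/
theorem stateVariance_eq_sub_sq {ρ : H →L[ℂ] H} (hρ : expectation ρ 1 = 1) (B : H →L[ℂ] H)
    (b : ℝ) :
    stateVariance ρ B =
      expectation ρ ((B - (b : ℂ) • (1 : H →L[ℂ] H)) ^ 2) - (expectation ρ B - b) ^ 2 := by
  set β := expectation ρ B with hβ
  have h : (B - (β : ℂ) • (1 : H →L[ℂ] H)) ^ 2 = (B - (b : ℂ) • (1 : H →L[ℂ] H)) ^ 2 +
      (((-2 * (β - b) : ℝ) : ℂ) • B + ((β ^ 2 - b ^ 2 : ℝ) : ℂ) • (1 : H →L[ℂ] H)) := by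
    ext x
    simp only [pow_two, mul_apply_eq_comp, sub_apply, smul_apply, add_apply,
      one_apply_eq_self, map_sub, map_smul]
    push_cast
    module
  rw [stateVariance, ← hβ, h, expectation_add, expectation_add, expectation_real_smul,
    expectation_real_smul, hρ, ← hβ]
  ring

theorem expectation_one_of_mem_pureStates [FiniteDimensional ℂ H] {R : Submodule ℂ H}
    {ψ : H →L[ℂ] H} (hψ : ψ ∈ pureStates R) : expectation ψ 1 = 1 := by
  rw [expectation, one_mul, (LinearMap.IsIdempotentElem.isProj_range _ hψ.1.isIdempotentElem).trace, hψ.2.1]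
  simp

theorem expectation_ketBra [FiniteDimensional ℂ H] (R : Submodule ℂ H) (A : H →L[ℂ] H)
    (v : Metric.sphere (0 : R) 1) :
    expectation (ketBra R v).1 A = (inner ℂ ((v : R) : H) (A (v : R))).re := by
  change (LinearMap.trace ℂ H
    ((A ∘SL InnerProductSpace.rankOne ℂ (v : R).1 (v : R).1 : H →L[ℂ] H) : H →ₗ[ℂ] H)).re = _
  rw [InnerProductSpace.comp_rankOne, InnerProductSpace.trace_rankOne]

/-- The compression of an operator to a subspace. -/
noncomputable def compression [FiniteDimensional ℂ H] (R : Submodule ℂ H) (A : H →L[ℂ] H) : R →ₗ[ℂ] R :=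
  (R.orthogonalProjectionOnto : H →ₗ[ℂ] R) ∘ₗ (A : H →ₗ[ℂ] H) ∘ₗ R.subtype

theorem inner_compression [FiniteDimensional ℂ H] (R : Submodule ℂ H) (A : H →L[ℂ] H) (x y : R) :
    inner ℂ x (compression R A y) = inner ℂ (x : H) (A y) :=
  Submodule.inner_orthogonalProjectionOnto_eq_of_mem_left x (A y)

theorem isSymmetric_compression [FiniteDimensional ℂ H] (R : Submodule ℂ H) {A : H →L[ℂ] H}
    (hA : (A : H →ₗ[ℂ] H).IsSymmetric) : (compression R A).IsSymmetric := fun x y => by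
  rw [inner_compression, ← inner_conj_symm, inner_compression, inner_conj_symm]
  exact hA x y

/-- Cyclicity of the trace moves the projection to the left of A, turning a trace over H into one
over R. -/
theorem expectation_microcanonicalState [FiniteDimensional ℂ H] (R : Submodule ℂ H)
    (A : H →L[ℂ] H) :
    expectation (microcanonicalState R) A =
      (LinearMap.trace ℂ R (compression R A)).re / Module.finrank ℂ R := by
  have h : ((A * microcanonicalState R : H →L[ℂ] H) : H →ₗ[ℂ] H) =
      (Module.finrank ℂ R : ℂ)⁻¹ • (((A : H →ₗ[ℂ] H) ∘ₗ R.subtype) ∘ₗ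
        (R.orthogonalProjectionOnto : H →ₗ[ℂ] R)) := by
    ext x
    change A ((Module.finrank ℂ R : ℂ)⁻¹ • R.starProjection x) = _
    rw [map_smul]
    rfl
  rw [expectation, h, map_smul, LinearMap.trace_comp_comm', smul_eq_mul, ← Complex.ofReal_natCast,
    ← Complex.ofReal_inv, Complex.re_ofReal_mul, mul_comm, div_eq_mul_inv]
  rfl

/-- The microcanonical value is the average of ⟨x, A x⟩ over an orthonormal basis of R. -/
theorem expectation_microcanonicalState_mem_Icc [FiniteDimensional ℂ H] {R : Submodule ℂ H}
    (hR : R ≠ ⊥) (A : H →L[ℂ] H) {m M : ℝ}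
    (h : ∀ x : H, ‖x‖ = 1 → (inner ℂ x (A x)).re ∈ Icc m M) :
    expectation (microcanonicalState R) A ∈ Icc m M := by
  have : Nontrivial R := Submodule.nontrivial_iff_ne_bot.2 hR
  have hd : (0 : ℝ) < Module.finrank ℂ R := by exact_mod_cast Module.finrank_pos
  let b := stdOrthonormalBasis ℂ R
  have hb : ∀ i, (inner ℂ (b i : H) (A (b i))).re ∈ Icc m M := fun i => h _ (b.norm_eq_one i)
  rw [expectation_microcanonicalState, LinearMap.trace_eq_sum_inner _ b, Complex.re_sum]
  simp only [inner_compression]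
  constructor
  · rw [le_div_iff₀ hd]
    simpa [mul_comm] using Finset.sum_le_sum fun i (_ : i ∈ Finset.univ) => (hb i).1
  · rw [div_le_iff₀ hd]
    simpa [mul_comm] using Finset.sum_le_sum fun i (_ : i ∈ Finset.univ) => (hb i).2

end expectation

/-! ### Concentration for random pure states -/

/-- Concentration of the expectation value of an observable in a random pure state around its
microcanonical value. -/
theorem haarPureState_real_lt_abs_expectation_sub_le {H : Type*} [NormedAddCommGroup H]
    [InnerProductSpace ℂ H] [FiniteDimensional ℂ H] [MeasurableSpace H] [BorelSpace H]
    {R : Submodule ℂ H} (hR : R ≠ ⊥) {A : H →L[ℂ] H} (hA : (A : H →ₗ[ℂ] H).IsSymmetric)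
    {m M t : ℝ} (hmM : m < M) (ht : 0 ≤ t)
    (h : ∀ x : H, ‖x‖ = 1 → (inner ℂ x (A x)).re ∈ Icc m M) :
    (haarPureState R).real {ψ | t < |expectation ψ.1 A -
        expectation (microcanonicalState R) A|} ≤
      2 * Real.exp (-(Module.finrank ℂ R * t ^ 2 / (8 * (M - m) ^ 2))) := by
  have : Nontrivial R := Submodule.nontrivial_iff_ne_bot.2 hR
  have hb := expectation_microcanonicalState_mem_Icc hR A h
  have hcont : Continuous fun ψ : H →L[ℂ] H => expectation ψ A := by
    have h1 : Continuous fun ψ : H →L[ℂ] H => A * ψ := by fun_prop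
    have h2 : Continuous (LinearMap.trace ℂ H ∘ₗ ContinuousLinearMap.coeLM ℂ) :=
      LinearMap.continuous_of_finiteDimensional (E := H →L[ℂ] H) _
    exact Complex.continuous_re.comp (h2.comp h1)
  have hmeas : MeasurableSet {ψ : pureStates R | t < |expectation ψ.1 A -
      expectation (microcanonicalState R) A|} :=
    (isOpen_lt continuous_const
      ((hcont.comp continuous_subtype_val).sub continuous_const).abs).measurableSet
  rw [haarPureState, map_measureReal_apply (continuous_ketBra R).measurable hmeas]
  have htail : ∀ T : R →ₗ[ℂ] R, T.IsSymmetric → (∀ x : R, ‖x‖ = 1 →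
      |(inner ℂ x (T x)).re - (LinearMap.trace ℂ R T).re / Module.finrank ℂ R| ≤ M - m) → _ :=
    fun T hT hx => uniformSphere_real_lt_inner_sub_le T hT (sub_pos.2 hmM) ht hx
  set T := compression R A with hTdef
  have hT : T.IsSymmetric := isSymmetric_compression R hA
  have hx : ∀ x : R, ‖x‖ = 1 →
      |(inner ℂ x (T x)).re - (LinearMap.trace ℂ R T).re / Module.finrank ℂ R| ≤ M - m := by
    intro x hx
    rw [hTdef, inner_compression, ← expectation_microcanonicalState]
    obtain ⟨h1, h2⟩ := h x hx
    exact abs_le.2 ⟨by linarith [hb.2], by linarith [hb.1]⟩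
  have h1 := htail T hT hx
  -- The lower tail of T is the upper tail of -T.
  have h2 := htail (-T) (fun x y => by simp [hT x y]) fun x hx1 => by
    rw [← abs_neg]
    convert hx x hx1 using 2
    simp
    ring
  refine (measureReal_mono ?_).trans ((measureReal_union_le _ _).trans
    ((add_le_add h1 h2).trans_eq (two_mul _).symm))
  intro v hv
  have hv' : t < |expectation (ketBra R v).1 A - expectation (microcanonicalState R) A| := hv
  rw [expectation_ketBra, ← inner_compression, ← hTdef, expectation_microcanonicalState,
    ← hTdef, lt_abs] at hv'
  refine hv'.imp id fun hlt => ?_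
  refine hlt.trans_eq ?_
  simp
  ring

/-- Tail bound for the variance of an observable in a random pure state. -/
theorem haarPureState_real_lt_abs_stateVariance_sub_le {H : Type*} [NormedAddCommGroup H]
    [InnerProductSpace ℂ H] [FiniteDimensional ℂ H] [MeasurableSpace H] [BorelSpace H]
    {R : Submodule ℂ H} (hR : R ≠ ⊥) {B : H →L[ℂ] H} (hB : (B : H →ₗ[ℂ] H).IsSymmetric)
    {ε δ : ℝ} (hδ : 0 ≤ δ) (hδε : δ ≤ ε) :
    (haarPureState R).real
      {ψ | ‖B‖ ^ 2 * ε < |stateVariance ψ.1 B - stateVariance (microcanonicalState R) B|} ≤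
      2 * Real.exp (-(Module.finrank ℂ R * (ε - δ) / 32)) +
        2 * Real.exp (-(Module.finrank ℂ R * δ ^ 2 / 128)) := by
  have := isProbabilityMeasure_haarPureState R hR
  -- The concentration lemma needs an interval of positive length, hence B ≠ 0.
  rcases eq_or_ne B 0 with rfl | hB0
  · have h0 : ∀ ρ : H →L[ℂ] H, stateVariance ρ 0 = 0 := fun ρ => by
      simp [stateVariance, expectation]
    simp only [h0]
    simp
    positivity
  have hn : 0 < ‖B‖ := norm_pos_iff.2 hB0
  have hBI : ∀ x : H, ‖x‖ = 1 → (inner ℂ x (B x)).re ∈ Icc (-‖B‖) ‖B‖ := fun x hx => by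
    refine abs_le.1 ((Complex.abs_re_le_norm _).trans ((norm_inner_le_norm _ _).trans ?_))
    simpa [hx] using B.le_opNorm x
  have hb := expectation_microcanonicalState_mem_Icc hR B hBI
  set b := expectation (microcanonicalState R) B with hbdef
  set D : H →L[ℂ] H := B - (b : ℂ) • (1 : H →L[ℂ] H) with hD
  have hDs : (D : H →ₗ[ℂ] H).IsSymmetric := fun x y => by
    have := hB x y
    simp only [ContinuousLinearMap.coe_coe] at this ⊢
    simp only [hD, sub_apply, smul_apply, one_apply_eq_self, inner_sub_left, inner_sub_right,
      inner_smul_left, inner_smul_right, this, Complex.conj_ofReal]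
  have hDn : ‖D‖ ≤ 2 * ‖B‖ := by
    refine ContinuousLinearMap.opNorm_le_bound _ (by positivity) fun x => ?_
    calc ‖D x‖ ≤ ‖B x‖ + ‖(b : ℂ) • x‖ := norm_sub_le _ _
      _ ≤ ‖B‖ * ‖x‖ + ‖B‖ * ‖x‖ := by
        rw [norm_smul, Complex.norm_real, Real.norm_eq_abs]
        gcongr
        · exact B.le_opNorm x
        · exact abs_le.2 hb
      _ = _ := by ring
  have hD2s : ((D ^ 2 : H →L[ℂ] H) : H →ₗ[ℂ] H).IsSymmetric := fun x y => by
    rw [pow_two]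
    exact (hDs (D x) y).trans (hDs x (D y))
  have hD2I : ∀ x : H, ‖x‖ = 1 → (inner ℂ x ((D ^ 2) x)).re ∈ Icc 0 (4 * ‖B‖ ^ 2) := by
    intro x hx
    have h1 : inner ℂ x ((D ^ 2) x) = inner ℂ (D x) (D x) := by
      rw [pow_two]
      exact (hDs x (D x)).symm
    have h2 : ‖D x‖ ≤ 2 * ‖B‖ := by simpa [hx] using D.le_of_opNorm_le hDn x
    have h3 : (inner ℂ (D x) (D x)).re = ‖D x‖ ^ 2 := inner_self_eq_norm_sq (𝕜 := ℂ) (D x)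
    rw [h1, h3]
    refine ⟨by positivity, ?_⟩
    calc ‖D x‖ ^ 2 ≤ (2 * ‖B‖) ^ 2 := by gcongr
      _ = _ := by ring
  have hs := Real.sq_sqrt (sub_nonneg.2 hδε)
  -- The interval lengths 2‖B‖ for B and 4‖B‖² for D² give the constants 32 = 8·2² and 128 = 8·4².
  have hY := haarPureState_real_lt_abs_expectation_sub_le hR hB
    (t := √(ε - δ) * ‖B‖) (by linarith) (by positivity) hBI
  have hX := haarPureState_real_lt_abs_expectation_sub_le hR hD2s
    (t := δ * ‖B‖ ^ 2) (by positivity) (by positivity) hD2I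
  have e1 : Module.finrank ℂ R * (√(ε - δ) * ‖B‖) ^ 2 / (8 * (‖B‖ - -‖B‖) ^ 2) =
      Module.finrank ℂ R * (ε - δ) / 32 := by
    rw [mul_pow, hs]
    field_simp
    ring
  have e2 : Module.finrank ℂ R * (δ * ‖B‖ ^ 2) ^ 2 / (8 * (4 * ‖B‖ ^ 2 - 0) ^ 2) =
      Module.finrank ℂ R * δ ^ 2 / 128 := by
    field_simp
    ring
  rw [e1] at hY
  rw [e2] at hX
  refine (measureReal_mono ?_).trans ((measureReal_union_le _ _).trans (add_le_add hY hX))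
  intro ψ hψ
  by_contra hcon
  rw [mem_union, not_or] at hcon
  have hY' : |expectation ψ.1 B - b| ≤ √(ε - δ) * ‖B‖ := le_of_not_gt hcon.1
  have hX' : |expectation ψ.1 (D ^ 2) - expectation (microcanonicalState R) (D ^ 2)| ≤
      δ * ‖B‖ ^ 2 := le_of_not_gt hcon.2
  have hψ' := hψ.out
  rw [stateVariance_eq_sub_sq (expectation_one_of_mem_pureStates ψ.2) B b, stateVariance,
    ← hbdef, ← hD] at hψ'
  have hY2 : (expectation ψ.1 B - b) ^ 2 ≤ (ε - δ) * ‖B‖ ^ 2 := by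
    rw [← sq_abs, ← hs, ← mul_pow]
    gcongr
  obtain ⟨h1, h2⟩ := abs_le.1 hX'
  -- As Y² enters with one sign only, it matters just for the lower bound -δ - (ε - δ) = -ε.
  refine absurd hψ' (not_lt.2 (abs_le.2 ⟨?_, ?_⟩))
  · linarith
  · linarith [sq_nonneg (expectation ψ.1 B - b), mul_nonneg (sub_nonneg.2 hδε) (sq_nonneg ‖B‖)]

/-! ### Choice of δ and the explicit bounds -/

theorem mainTheorem2 {H : Type*} [NormedAddCommGroup H] [InnerProductSpace ℂ H]
    [FiniteDimensional ℂ H] [MeasurableSpace H] [BorelSpace H]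
    (R : Submodule ℂ H) (hR : R ≠ ⊥)
    (B : H →L[ℂ] H) (hB : (B : H →ₗ[ℂ] H).IsSymmetric)
    (ε : ℝ) (hε : 0 ≤ ε)
    (C : ℝ) (hC : C = (36 * Real.pi ^ 3)⁻¹)
    (d : ℕ) (hd : d = Module.finrank ℂ R)
    (p : ℝ) (hp : p = (haarPureState R).real
      {ψ | ‖B‖ ^ 2 * ε < |stateVariance ψ.1 B - stateVariance (microcanonicalState R) B|}) :
    (∃ m : ℝ,
      IsLeast ((fun δ : ℝ => 2 * Real.exp (-(C * d * (ε - δ))) + 2 * Real.exp (-(C * d * δ ^ 2))) ''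
        Icc 0 ε) m ∧
      p ≤ m ∧
      m ≤ 4 * Real.exp (-(C * d) * (1 + 2 * ε - √(1 + 4 * ε)) / 2)) ∧
    p ≤ 4 * Real.exp (-(C * d) * (1 + 2 * ε - √(1 + 4 * ε))) := by
  have hC0 : 0 ≤ C := by rw [hC]; positivity
  have hC1 : 2 * C ≤ 1 / 128 := by
    have h3 : (3 : ℝ) ^ 3 ≤ Real.pi ^ 3 := by
      gcongr
      exact Real.pi_gt_three.le
    have : C ≤ (36 * 3 ^ 3 : ℝ)⁻¹ := by
      rw [hC]
      gcongr
    linarith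
  -- The rate 2C here yields the last bound; halving it gives the one being minimised.
  have key : ∀ δ ∈ Icc 0 ε, p ≤ 2 * Real.exp (-(2 * C * d * (ε - δ))) +
      2 * Real.exp (-(2 * C * d * δ ^ 2)) := by
    rintro δ ⟨h0, h1⟩
    rw [hp]
    refine (haarPureState_real_lt_abs_stateVariance_sub_le hR hB h0 h1).trans ?_
    rw [← hd]
    have hu : 0 ≤ d * (ε - δ) := mul_nonneg d.cast_nonneg (sub_nonneg.2 h1)
    have hv : 0 ≤ d * δ ^ 2 := by positivity
    gcongr <;> nlinarith
  have hmono : ∀ δ ∈ Icc 0 ε, p ≤ 2 * Real.exp (-(C * d * (ε - δ))) +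
      2 * Real.exp (-(C * d * δ ^ 2)) := by
    intro δ hδ
    refine (key δ hδ).trans ?_
    have hu : 0 ≤ C * d * (ε - δ) :=
      mul_nonneg (mul_nonneg hC0 d.cast_nonneg) (sub_nonneg.2 hδ.2)
    have hv : 0 ≤ C * d * δ ^ 2 := by positivity
    gcongr 2 * Real.exp ?_ + 2 * Real.exp ?_ <;> linarith
  obtain ⟨s, hs⟩ : ∃ s, s = √(1 + 4 * ε) := ⟨_, rfl⟩
  have hs2 : s ^ 2 = 1 + 4 * ε := by rw [hs, Real.sq_sqrt (by linarith)]
  have hs0 : 0 ≤ s := hs ▸ Real.sqrt_nonneg _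
  have hs1 : 1 ≤ s := by nlinarith
  -- This δ solves δ² = ε - δ, which equalises the two exponents.
  have hmem : (s - 1) / 2 ∈ Icc 0 ε := ⟨by linarith, by nlinarith⟩
  have e1 : ε - (s - 1) / 2 = (1 + 2 * ε - s) / 2 := by ring
  have e2 : ((s - 1) / 2) ^ 2 = (1 + 2 * ε - s) / 2 := by linarith
  rw [← hs]
  constructor
  · obtain ⟨m, hm⟩ := (isCompact_Icc.image (f := fun δ : ℝ =>
      2 * Real.exp (-(C * d * (ε - δ))) + 2 * Real.exp (-(C * d * δ ^ 2)))
      (by fun_prop)).exists_isLeast ((nonempty_Icc.2 hε).image _)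
    refine ⟨m, hm, ?_, ?_⟩
    · obtain ⟨δ, hδ, rfl⟩ := hm.1
      exact hmono δ hδ
    · refine (hm.2 (mem_image_of_mem _ hmem)).trans_eq ?_
      simp only [e1, e2]
      ring_nf
  · refine (key _ hmem).trans_eq ?_
    rw [e1, e2]
    ring_nf
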